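/- Let $S^\infty$ denote the unit sphere of the real Hilbert space $\ell^2$, with inner product $\cdot$ and endowed with its geodesic distance $(x,y)\mapsto\arccos(x\cdot y)$. Let $K$ be a continuous real kernel on $S^\infty\times S^\infty$ (that is, a continuous real function on $(S^\infty\times S^\infty)^2$) which is isotropic: there is a real function $f$ on $[-1,1]^2$, called the isotropic part of $K$, such that $$K((x,z),(y,w))=f(x\cdot y,\,z\cdot w),\qquad x,y,z,w\in S^\infty .$$ Then $K$ is positive definite, i.e. $\sum_{\mu,\nu=1}^n c_\mu c_\nu K(p_\mu,p_\nu)\ge 0$ for all $n\ge 1$, all distinct points $p_1,\dots,p_n\in S^\infty\times S^\infty$ and all real numbers $c_1,\dots,c_n$, if and only if $f$ has a representation of the form $$f(t,s)=\sum_{k,l=0}^{\infty} f_{k,l}\,t^k s^l,\qquad t,s\in[-1,1],$$ in which $f_{k,l}\ge 0$ for all integers $k,l\ge 0$ and $\sum_{k,l=0}^\infty f_{k,l}<\infty$ (with the convention $0^0=1$). -/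

import Mathlib

/-- The real Hilbert sphere: the unit sphere of the real sequence space `ℓ²`. -/
abbrev HilbertSphere : Type :=
  Metric.sphere (0 : lp (fun _ : ℕ => ℝ) 2) 1

/-- The inner product of two points of the Hilbert sphere. -/
noncomputable def HilbertSphere.dot (x y : HilbertSphere) : ℝ :=
  inner ℝ (x : lp (fun _ : ℕ => ℝ) 2) (y : lp (fun _ : ℕ => ℝ) 2)

/-- The geodesic distance on the Hilbert sphere. -/
noncomputable def HilbertSphere.geodesicDist (x y : HilbertSphere) : ℝ :=
  Real.arccos (HilbertSphere.dot x y)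

/-- A real kernel `K` on a set `X` is positive definite if
`∑ μ, ∑ ν, c μ * c ν * K (x μ) (x ν) ≥ 0` for all `n ≥ 1`, all distinct points
`x 1, …, x n` of `X` and all real scalars `c 1, …, c n`. -/
def IsPositiveDefiniteKernel {X : Type*} (K : X → X → ℝ) : Prop :=
  ∀ n : ℕ, 1 ≤ n → ∀ x : Fin n → X, Function.Injective x → ∀ c : Fin n → ℝ,
    0 ≤ ∑ μ, ∑ ν, c μ * c ν * K (x μ) (x ν)

/-- `f` is the isotropic part of the kernel `K`:
`K ((x, z), (y, w)) = f (x · y, z · w)`. Only the values of `f` on `[-1, 1]²` matter. -/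
def IsIsotropicPart
    (K : HilbertSphere × HilbertSphere → HilbertSphere × HilbertSphere → ℝ)
    (f : ℝ → ℝ → ℝ) : Prop :=
  ∀ x y z w : HilbertSphere,
    K (x, z) (y, w) = f (HilbertSphere.dot x y) (HilbertSphere.dot z w)

/-- Joint continuity of a kernel, each sphere being endowed with the geodesic distance. -/
def IsContinuousKernel
    (K : HilbertSphere × HilbertSphere → HilbertSphere × HilbertSphere → ℝ) : Prop :=
  ∀ p q : HilbertSphere × HilbertSphere, ∀ ε > 0, ∃ δ > 0,
    ∀ p' q' : HilbertSphere × HilbertSphere,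
      HilbertSphere.geodesicDist p'.1 p.1 < δ → HilbertSphere.geodesicDist p'.2 p.2 < δ →
      HilbertSphere.geodesicDist q'.1 q.1 < δ → HilbertSphere.geodesicDist q'.2 q.2 < δ →
      |K p' q' - K p q| < ε

/-!
By Schur's product theorem every kernel `(x · y) ^ k * (z · w) ^ l` is positive definite, and
positive definiteness passes to convergent series with nonnegative coefficients.

Conversely, the vertices of a `d`-dimensional cube inscribed in the sphere are indexed by the sign
vectors `σ`, and the inner product of two of them is the mean of `σ * τ`. Restricted to a product of
two such cubes, the kernel is a function of the product of two elements of a finite group of sign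
vectors, so that its Walsh coefficients are nonnegative. Up to grouping they are the coefficients of
the Bernstein polynomial of degree `d` of `f`, that is, the expectation of `f` at the means of two
families of `d` independent signs with expectations `t` and `s`. These polynomials converge to `f`.
Their values at `(1, 1)`, the sums of their coefficients, are bounded, so a subsequence converges
coefficientwise. Dominated convergence identifies the limit with `f` on the open square, and
continuity does so up to the boundary.
-/

open Finset Filter Topology

section Korovkin

theorem abs_sum_mul_sub_le {Ω : Type*} [Fintype Ω] {w y v : Ω → ℝ} {c ε C : ℝ}
    (hw : ∀ ω, 0 ≤ w ω) (hw1 : ∑ ω, w ω = 1) (hy : ∀ ω, |y ω - c| ≤ ε + C * v ω) :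
    |∑ ω, w ω * y ω - c| ≤ ε + C * ∑ ω, w ω * v ω :=
  calc |∑ ω, w ω * y ω - c|
      = |∑ ω, w ω * (y ω - c)| := by
        simp only [mul_sub, sum_sub_distrib, ← sum_mul, hw1, one_mul]
    _ ≤ ∑ ω, w ω * |y ω - c| :=
        (abs_sum_le_sum_abs _ _).trans_eq <| by simp only [abs_mul, abs_of_nonneg (hw _)]
    _ ≤ ∑ ω, w ω * (ε + C * v ω) :=
        sum_le_sum fun ω _ => mul_le_mul_of_nonneg_left (hy ω) (hw ω)
    _ = ε + C * ∑ ω, w ω * v ω := by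
        simp only [mul_add, sum_add_distrib, ← sum_mul, hw1, one_mul, mul_left_comm _ C, ← mul_sum]

variable {X : Type*} [PseudoMetricSpace X] {S : Set X} {F : X → ℝ} {x : X} {M : ℝ}

theorem exists_abs_sub_le_add_mul_dist_sq (hM : ∀ y ∈ S, |F y| ≤ M)
    (hF : ContinuousWithinAt F S x) (hx : x ∈ S) {ε : ℝ} (hε : 0 < ε) :
    ∃ C, ∀ y ∈ S, |F y - F x| ≤ ε + C * dist y x ^ 2 := by
  obtain ⟨δ, hδ, hclose⟩ := Metric.continuousWithinAt_iff.mp hF ε hε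
  have hM0 : 0 ≤ M := (abs_nonneg _).trans (hM x hx)
  refine ⟨2 * M / δ ^ 2, fun y hy => ?_⟩
  rcases lt_or_ge (dist y x) δ with hnear | hfar
  · have hFy : |F y - F x| < ε := hclose hy hnear
    have : 0 ≤ 2 * M / δ ^ 2 * dist y x ^ 2 := by positivity
    linarith
  · calc |F y - F x| ≤ |F y| + |F x| := abs_sub _ _
      _ ≤ 2 * M := by linarith [hM y hy, hM x hx]
      _ = 2 * M / δ ^ 2 * δ ^ 2 := by field_simp
      _ ≤ 2 * M / δ ^ 2 * dist y x ^ 2 := by gcongr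
      _ ≤ ε + 2 * M / δ ^ 2 * dist y x ^ 2 := le_add_of_nonneg_left hε.le

theorem tendsto_sum_mul_of_tendsto_sum_mul_dist_sq {α : Type*} {l : Filter α} {Ω : α → Type*}
    [∀ a, Fintype (Ω a)] {w : ∀ a, Ω a → ℝ} {p : ∀ a, Ω a → X} (hM : ∀ y ∈ S, |F y| ≤ M)
    (hF : ContinuousWithinAt F S x) (hx : x ∈ S) (hw : ∀ a ω, 0 ≤ w a ω)
    (hw1 : ∀ a, ∑ ω, w a ω = 1) (hp : ∀ a ω, p a ω ∈ S)
    (hvar : Tendsto (fun a => ∑ ω, w a ω * dist (p a ω) x ^ 2) l (𝓝 0)) :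
    Tendsto (fun a => ∑ ω, w a ω * F (p a ω)) l (𝓝 (F x)) := by
  rw [Metric.tendsto_nhds]
  intro ε hε
  obtain ⟨C, hC⟩ := exists_abs_sub_le_add_mul_dist_sq hM hF hx (half_pos hε)
  have hsmall : ∀ᶠ a in l, C * ∑ ω, w a ω * dist (p a ω) x ^ 2 < ε / 2 :=
    (by simpa using hvar.const_mul C :
      Tendsto (fun a => C * ∑ ω, w a ω * dist (p a ω) x ^ 2) l (𝓝 0)).eventually_lt_const
        (half_pos hε)
  filter_upwards [hsmall] with a ha
  rw [Real.dist_eq]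
  linarith [abs_sum_mul_sub_le (hw a) (hw1 a) fun ω => hC (p a ω) (hp a ω)]

end Korovkin

section NonnegExpansion

theorem exists_subseq_tendsto_summable {P : Type*} [Countable P] {b : ℕ → P → ℝ} {C : ℝ}
    (hb : ∀ n p, 0 ≤ b n p) (hC : ∀ n (s : Finset P), ∑ p ∈ s, b n p ≤ C) :
    ∃ a : P → ℝ, (∀ p, 0 ≤ a p) ∧ Summable a ∧
      ∃ φ : ℕ → ℕ, StrictMono φ ∧ ∀ p, Tendsto (fun n => b (φ n) p) atTop (𝓝 (a p)) := by
  obtain ⟨a, ha, φ, hφ, hconv⟩ :=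
    (isCompact_univ_pi fun _ : P => isCompact_Icc (a := (0 : ℝ)) (b := C)).tendsto_subseq
      (x := b) fun n p _ => ⟨hb n p, by simpa using hC n {p}⟩
  rw [tendsto_pi_nhds] at hconv
  have ha0 : ∀ p, 0 ≤ a p := fun p => (ha p trivial).1
  refine ⟨a, ha0, summable_of_sum_le ha0 (c := C) fun s => ?_, φ, hφ, hconv⟩
  exact le_of_tendsto' (tendsto_finsetSum s fun p _ => hconv p) fun n => hC (φ n) s

/-- `F` is, on `S`, the sum of a series in the functions `u p` with nonnegative summable
coefficients. Isotropic parts of positive definite kernels are characterized by taking for `u` the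
monomials in two variables. -/
def HasNonnegExpansion {P X : Type*} (u : P → X → ℝ) (S : Set X) (F : X → ℝ) : Prop :=
  ∃ a : P → ℝ, (∀ p, 0 ≤ a p) ∧ Summable a ∧ ∀ x ∈ S, HasSum (fun p => a p * u p x) (F x)

variable {P X : Type*} {u : P → X → ℝ} {S : Set X}

theorem hasNonnegExpansion_sum {Q : Type*} [Fintype Q] (deg : Q → P) {c : Q → ℝ}
    (hc : ∀ q, 0 ≤ c q) : HasNonnegExpansion u S fun x => ∑ q, c q * u (deg q) x := by
  classical
  refine ⟨fun p => ∑ q, if p = deg q then c q else 0,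
    fun p => sum_nonneg fun q _ => by split_ifs <;> simp [hc], ?_, fun x _ => ?_⟩
  · exact (hasSum_sum fun q _ => hasSum_ite_eq (deg q) (c q)).summable
  · convert hasSum_sum fun q _ => hasSum_ite_eq (deg q) (c q * u (deg q) x) using 2 with p
    rw [sum_mul]
    exact sum_congr rfl fun q _ => by split_ifs with h <;> simp [h]

theorem HasNonnegExpansion.of_tendsto [Countable P] [TopologicalSpace X] {T : Set X}
    {F : X → ℝ} {G : ℕ → X → ℝ} {x₀ : X}
    (hG : ∀ n, HasNonnegExpansion u S (G n))
    (hlim : ∀ x ∈ S, Tendsto (fun n => G n x) atTop (𝓝 (F x))) (hF : ContinuousOn F S)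
    (hu : ∀ p, ContinuousOn (u p) S) (hu1 : ∀ p, ∀ x ∈ S, |u p x| ≤ 1)
    (hx₀ : x₀ ∈ S) (hux₀ : ∀ p, u p x₀ = 1)
    (hTS : T ⊆ S) (hST : S ⊆ closure T) (huT : ∀ x ∈ T, Summable fun p => u p x) :
    HasNonnegExpansion u S F := by
  choose b hb _ hbG using hG
  obtain ⟨C, hC⟩ := (hlim x₀ hx₀).bddAbove_range
  have hbC : ∀ n (s : Finset P), ∑ p ∈ s, b n p ≤ C := fun n s =>
    (sum_le_hasSum s (fun p _ => hb n p) (by simpa [hux₀] using hbG n x₀ hx₀)).trans (hC ⟨n, rfl⟩)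
  obtain ⟨a, ha, hsum, φ, hφ, hconv⟩ := exists_subseq_tendsto_summable hb hbC
  have hbound : ∀ p, ∀ x ∈ S, ‖a p * u p x‖ ≤ a p := fun p x hx => by
    rw [norm_mul, Real.norm_of_nonneg (ha p)]
    exact mul_le_of_le_one_right (ha p) (hu1 p x hx)
  have hcont : ContinuousOn (fun x => ∑' p, a p * u p x) S :=
    continuousOn_tsum (fun p => continuousOn_const.mul (hu p)) hsum hbound
  have heqT : Set.EqOn (fun x => ∑' p, a p * u p x) F T := fun x hx => by
    have htsum : Tendsto (fun n => ∑' p, b (φ n) p * u p x) atTop (𝓝 (∑' p, a p * u p x)) := by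
      refine tendsto_tsum_of_dominated_convergence ((huT x hx).norm.mul_left C)
        (fun p => (hconv p).mul_const _) (Eventually.of_forall fun n p => ?_)
      rw [norm_mul, Real.norm_of_nonneg (hb _ p)]
      exact mul_le_mul_of_nonneg_right (by simpa using hbC (φ n) {p}) (norm_nonneg _)
    refine tendsto_nhds_unique htsum (((hlim x (hTS hx)).comp hφ.tendsto_atTop).congr fun n => ?_)
    exact (hbG (φ n) x (hTS hx)).tsum_eq.symm
  have heqS : Set.EqOn (fun x => ∑' p, a p * u p x) F S :=
    heqT.of_subset_closure hcont hF hTS hST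
  exact ⟨a, ha, hsum, fun x hx =>
    (Summable.of_norm_bounded hsum fun p => hbound p x hx).hasSum_iff.mpr (heqS hx)⟩

end NonnegExpansion

section Monomials

/-- The monomial `(t, s) ↦ t ^ k * s ^ l`, indexed by the pair `(k, l)`. -/
def bivariateMonomial (p : ℕ × ℕ) (x : ℝ × ℝ) : ℝ := x.1 ^ p.1 * x.2 ^ p.2

theorem abs_bivariateMonomial_le_one (p : ℕ × ℕ) {x : ℝ × ℝ}
    (hx : x ∈ Set.Icc (-1 : ℝ) 1 ×ˢ Set.Icc (-1 : ℝ) 1) : |bivariateMonomial p x| ≤ 1 := by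
  rw [bivariateMonomial, abs_mul, abs_pow, abs_pow]
  exact mul_le_one₀ (pow_le_one₀ (abs_nonneg _) (abs_le.mpr hx.1)) (by positivity)
    (pow_le_one₀ (abs_nonneg _) (abs_le.mpr hx.2))

theorem summable_bivariateMonomial {x : ℝ × ℝ}
    (hx : x ∈ Set.Ioo (-1 : ℝ) 1 ×ˢ Set.Ioo (-1 : ℝ) 1) :
    Summable fun p => bivariateMonomial p x :=
  summable_mul_of_summable_norm
    (summable_norm_geometric_of_norm_lt_one (abs_lt.mpr hx.1))
    (summable_norm_geometric_of_norm_lt_one (abs_lt.mpr hx.2))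

theorem HasNonnegExpansion.bivariateMonomial_of_tendsto {F : ℝ × ℝ → ℝ} {G : ℕ → ℝ × ℝ → ℝ}
    (hG : ∀ n, HasNonnegExpansion bivariateMonomial (Set.Icc (-1) 1 ×ˢ Set.Icc (-1) 1) (G n))
    (hlim : ∀ x ∈ Set.Icc (-1 : ℝ) 1 ×ˢ Set.Icc (-1 : ℝ) 1,
      Tendsto (fun n => G n x) atTop (𝓝 (F x)))
    (hF : ContinuousOn F (Set.Icc (-1) 1 ×ˢ Set.Icc (-1) 1)) :
    HasNonnegExpansion bivariateMonomial (Set.Icc (-1) 1 ×ˢ Set.Icc (-1) 1) F := by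
  refine .of_tendsto (x₀ := (1, 1)) (T := Set.Ioo (-1) 1 ×ˢ Set.Ioo (-1) 1) hG hlim hF
    (fun p => ?_) (fun p _ => abs_bivariateMonomial_le_one p) (by simp)
    (by simp [bivariateMonomial])
    (Set.prod_mono Set.Ioo_subset_Icc_self Set.Ioo_subset_Icc_self) ?_
    fun _ => summable_bivariateMonomial
  · unfold bivariateMonomial
    fun_prop
  · rw [closure_prod_eq, closure_Ioo (by norm_num)]

end Monomials

section Signs

theorem abs_cast_intUnits (u : ℤˣ) : |(u : ℝ)| = 1 := by
  rcases Int.units_eq_one_or u with rfl | rfl <;> simp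

/-- The mean of a family of signs. -/
noncomputable def signMean {ι : Type*} [Fintype ι] (σ : ι → ℤˣ) : ℝ :=
  (∑ i, (σ i : ℝ)) / Fintype.card ι

theorem signMean_mem_Icc {ι : Type*} [Fintype ι] (σ : ι → ℤˣ) :
    signMean σ ∈ Set.Icc (-1 : ℝ) 1 := by
  rw [Set.mem_Icc, ← abs_le, signMean, abs_div, Nat.abs_cast]
  refine div_le_one_of_le₀ ((abs_sum_le_sum_abs _ _).trans ?_) (Nat.cast_nonneg _)
  simp [abs_cast_intUnits]

theorem signMean_mul_self {ι : Type*} [Fintype ι] [Nonempty ι] (σ : ι → ℤˣ) :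
    signMean (σ * σ) = 1 := by
  simp [signMean]

/-- The Walsh function of `A`, that is, the character `σ ↦ ∏ j ∈ A, σ j` of the group of sign
vectors. -/
def walshChar {J : Type*} (A : Finset J) : (J → ℤˣ) →* ℝ where
  toFun σ := ∏ j ∈ A, (σ j : ℝ)
  map_one' := by simp
  map_mul' σ τ := by simp [prod_mul_distrib]

variable {J : Type*} [Fintype J]

/-- The probability of the sign vector `σ` when the signs are independent, the `j`-th one having
expectation `x j`. -/
noncomputable def signWeight (x : J → ℝ) (σ : J → ℤˣ) : ℝ := ∏ j, (1 + (σ j : ℝ) * x j) / 2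

theorem signWeight_nonneg {x : J → ℝ} (hx : ∀ j, x j ∈ Set.Icc (-1 : ℝ) 1) (σ : J → ℤˣ) :
    0 ≤ signWeight x σ := by
  refine prod_nonneg fun j _ => div_nonneg ?_ zero_le_two
  have hbias : |(σ j : ℝ) * x j| ≤ 1 := by
    simpa only [abs_mul, abs_cast_intUnits, one_mul] using abs_le.mpr (hx j)
  linarith [neg_le_of_abs_le hbias]

theorem signWeight_eq_sum_walshChar (x : J → ℝ) (σ : J → ℤˣ) :
    signWeight x σ = (2 ^ Fintype.card J)⁻¹ * ∑ A, walshChar A σ * ∏ j ∈ A, x j := by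
  rw [signWeight, prod_div_distrib, prod_one_add, powerset_univ]
  simp [walshChar, prod_mul_distrib, div_eq_inv_mul]

variable [DecidableEq J]

/-- The expectation of `g` over independent signs, the `j`-th one having expectation `x j`. As a
function of `x` it is the multilinear extension of `g` from the vertices of the cube. -/
noncomputable def signExpectation (x : J → ℝ) (g : (J → ℤˣ) → ℝ) : ℝ :=
  ∑ σ, signWeight x σ * g σ

/-- The coefficient of `∏ j ∈ A, x j` in the multilinear polynomial `signExpectation x g`. -/
noncomputable def walshCoeff (g : (J → ℤˣ) → ℝ) (A : Finset J) : ℝ :=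
  (2 ^ Fintype.card J)⁻¹ * ∑ σ, walshChar A σ * g σ

theorem signExpectation_eq_sum_walshCoeff (x : J → ℝ) (g : (J → ℤˣ) → ℝ) :
    signExpectation x g = ∑ A, walshCoeff g A * ∏ j ∈ A, x j := by
  simp only [signExpectation, signWeight_eq_sum_walshChar, walshCoeff, mul_sum, sum_mul]
  rw [sum_comm]
  exact sum_congr rfl fun A _ => sum_congr rfl fun σ _ => by ring

theorem signExpectation_prod (x : J → ℝ) (h : J → ℤˣ → ℝ) :
    signExpectation x (fun σ => ∏ j, h j (σ j)) =
      ∏ j, ((1 + x j) / 2 * h j 1 + (1 - x j) / 2 * h j (-1)) := by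
  simp only [signExpectation, signWeight, ← prod_mul_distrib]
  rw [← Fintype.prod_sum fun j (u : ℤˣ) => (1 + (u : ℝ) * x j) / 2 * h j u]
  refine prod_congr rfl fun j _ => ?_
  rw [show (univ : Finset ℤˣ) = {1, -1} from rfl, sum_pair (by decide)]
  simp [sub_eq_add_neg]

theorem sum_signWeight (x : J → ℝ) : ∑ σ, signWeight x σ = 1 := by
  have h := signExpectation_prod x fun _ _ => 1
  simp only [signExpectation, prod_const_one, mul_one] at h
  exact h.trans (prod_eq_one fun _ _ => by ring)

theorem signExpectation_covariance (x : J → ℝ) (j k : J) :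
    signExpectation x (fun σ => ((σ j : ℝ) - x j) * ((σ k : ℝ) - x k)) =
      if j = k then 1 - x j ^ 2 else 0 := by
  have h := signExpectation_prod x fun i u =>
    (if i = j then (u : ℝ) - x i else 1) * (if i = k then (u : ℝ) - x i else 1)
  simp only [prod_mul_distrib, prod_ite_eq', mem_univ, if_true] at h
  rw [h]
  split_ifs with hjk
  · subst hjk
    rw [prod_eq_single j (fun i _ hi => by simp only [hi, ↓reduceIte, mul_one]; ring) (by simp)]
    simp only [↓reduceIte, Units.val_one, Int.cast_one, Units.val_neg, Int.cast_neg]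
    ring
  · refine prod_eq_zero (mem_univ j) ?_
    simp only [↓reduceIte, hjk, mul_one, Units.val_one, Int.cast_one, Units.val_neg, Int.cast_neg]
    ring

theorem signExpectation_sq_signMean_comp_sub {ι : Type*} [Fintype ι] [Nonempty ι] {x : J → ℝ}
    {e : ι → J} (he : Function.Injective e) {t : ℝ} (hx : ∀ i, x (e i) = t) :
    signExpectation x (fun σ => (signMean (σ ∘ e) - t) ^ 2) = (1 - t ^ 2) / Fintype.card ι := by
  classical
  have hsq : ∀ σ : J → ℤˣ, (signMean (σ ∘ e) - t) ^ 2 =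
      (∑ i, ∑ k, ((σ (e i) : ℝ) - x (e i)) * ((σ (e k) : ℝ) - x (e k))) /
        (Fintype.card ι : ℝ) ^ 2 := fun σ => by
    rw [← sum_mul_sum, ← sq, ← div_pow, signMean]
    simp only [hx, sum_sub_distrib, sum_const, card_univ, nsmul_eq_mul, Function.comp_apply]
    field_simp
  have hswap : signExpectation x (fun σ => (signMean (σ ∘ e) - t) ^ 2) =
      (∑ i, ∑ k, signExpectation x fun σ =>
        ((σ (e i) : ℝ) - x (e i)) * ((σ (e k) : ℝ) - x (e k))) / (Fintype.card ι : ℝ) ^ 2 := by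
    simp only [signExpectation, hsq, ← mul_div_assoc, ← sum_div, mul_sum]
    rw [sum_comm]
    simp only [sum_comm (s := (univ : Finset (J → ℤˣ)))]
  rw [hswap]
  simp only [signExpectation_covariance, he.eq_iff, sum_ite_eq, mem_univ, if_true]
  simp only [hx, sum_const, card_univ, nsmul_eq_mul]
  field_simp

end Signs

section Bernstein

variable {ι : Type*}

/-- The vector of expectations assigning `x.1` to the first half and `x.2` to the second half of a
family of signs indexed by `ι ⊕ ι`. -/
def signBias (x : ℝ × ℝ) : ι ⊕ ι → ℝ := Sum.elim (fun _ => x.1) fun _ => x.2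

theorem signBias_mem_Icc {x : ℝ × ℝ} (hx : x ∈ Set.Icc (-1 : ℝ) 1 ×ˢ Set.Icc (-1 : ℝ) 1)
    (j : ι ⊕ ι) : signBias x j ∈ Set.Icc (-1 : ℝ) 1 := by
  cases j
  exacts [hx.1, hx.2]

theorem prod_signBias (x : ℝ × ℝ) (A : Finset (ι ⊕ ι)) :
    ∏ j ∈ A, signBias x j = bivariateMonomial (#A.toLeft, #A.toRight) x := by
  rw [← toLeft_disjSum_toRight (u := A), prod_disjSum]
  simp [signBias, bivariateMonomial]

variable [Fintype ι]

/-- The means of the two halves of a family of signs indexed by `ι ⊕ ι`. -/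
noncomputable def signMeanPair (σ : ι ⊕ ι → ℤˣ) : ℝ × ℝ :=
  (signMean (σ ∘ Sum.inl), signMean (σ ∘ Sum.inr))

theorem signMeanPair_mem (σ : ι ⊕ ι → ℤˣ) :
    signMeanPair σ ∈ Set.Icc (-1 : ℝ) 1 ×ˢ Set.Icc (-1 : ℝ) 1 :=
  ⟨signMean_mem_Icc _, signMean_mem_Icc _⟩

variable [DecidableEq ι]

/-- The Bernstein polynomial of `F` for the square `[-1, 1]²`, of degree at most `card ι` in each
variable: the expectation at `(t, s)` of `F` evaluated at the means of `card ι` independent signs of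
expectation `t` and `card ι` independent signs of expectation `s`. -/
noncomputable def signBernstein (ι : Type*) [Fintype ι] [DecidableEq ι] (F : ℝ × ℝ → ℝ)
    (x : ℝ × ℝ) : ℝ :=
  signExpectation (signBias x) fun σ : ι ⊕ ι → ℤˣ => F (signMeanPair σ)

theorem hasNonnegExpansion_signBernstein {F : ℝ × ℝ → ℝ}
    (hF : ∀ A, 0 ≤ walshCoeff (fun σ : ι ⊕ ι → ℤˣ => F (signMeanPair σ)) A) (S : Set (ℝ × ℝ)) :
    HasNonnegExpansion bivariateMonomial S (signBernstein ι F) := by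
  have hwalsh : signBernstein ι F = fun x =>
      ∑ A, walshCoeff (fun σ : ι ⊕ ι → ℤˣ => F (signMeanPair σ)) A *
        bivariateMonomial (#A.toLeft, #A.toRight) x := by
    funext x
    simp only [signBernstein, signExpectation_eq_sum_walshCoeff, prod_signBias]
  rw [hwalsh]
  exact hasNonnegExpansion_sum (fun A : Finset (ι ⊕ ι) => (#A.toLeft, #A.toRight)) hF

theorem signExpectation_dist_sq_signMeanPair_le [Nonempty ι] {x : ℝ × ℝ}
    (hx : x ∈ Set.Icc (-1 : ℝ) 1 ×ˢ Set.Icc (-1 : ℝ) 1) :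
    signExpectation (signBias x) (fun σ : ι ⊕ ι → ℤˣ => dist (signMeanPair σ) x ^ 2) ≤
      2 / Fintype.card ι := by
  have hdist : ∀ y : ℝ × ℝ, dist y x ^ 2 ≤ (y.1 - x.1) ^ 2 + (y.2 - x.2) ^ 2 := fun y => by
    rw [Prod.dist_eq, Real.dist_eq, Real.dist_eq]
    rcases max_cases |y.1 - x.1| |y.2 - x.2| with ⟨h, -⟩ | ⟨h, -⟩ <;> rw [h, sq_abs] <;>
      linarith [sq_nonneg (y.1 - x.1), sq_nonneg (y.2 - x.2)]
  calc signExpectation (signBias x) (fun σ : ι ⊕ ι → ℤˣ => dist (signMeanPair σ) x ^ 2)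
      ≤ signExpectation (signBias x) (fun σ : ι ⊕ ι → ℤˣ =>
          ((signMeanPair σ).1 - x.1) ^ 2 + ((signMeanPair σ).2 - x.2) ^ 2) :=
        sum_le_sum fun σ _ => mul_le_mul_of_nonneg_left (hdist _)
          (signWeight_nonneg (signBias_mem_Icc hx) σ)
    _ = (1 - x.1 ^ 2) / Fintype.card ι + (1 - x.2 ^ 2) / Fintype.card ι := by
        rw [← signExpectation_sq_signMean_comp_sub (x := signBias x) Sum.inl_injective fun _ => rfl,
          ← signExpectation_sq_signMean_comp_sub (x := signBias x) Sum.inr_injective fun _ => rfl]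
        simp only [signExpectation, mul_add, sum_add_distrib, signMeanPair]
    _ ≤ 2 / Fintype.card ι := by
        rw [← add_div]
        gcongr
        linarith [sq_nonneg x.1, sq_nonneg x.2]

theorem tendsto_signBernstein {F : ℝ × ℝ → ℝ}
    (hF : ContinuousOn F (Set.Icc (-1) 1 ×ˢ Set.Icc (-1) 1)) {x : ℝ × ℝ}
    (hx : x ∈ Set.Icc (-1 : ℝ) 1 ×ˢ Set.Icc (-1 : ℝ) 1) :
    Tendsto (fun d : ℕ => signBernstein (Fin (d + 1)) F x) atTop (𝓝 (F x)) := by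
  obtain ⟨M, hM⟩ := (isCompact_Icc.prod isCompact_Icc).exists_bound_of_continuousOn hF
  have hw : ∀ d, ∀ σ : Fin (d + 1) ⊕ Fin (d + 1) → ℤˣ, 0 ≤ signWeight (signBias x) σ :=
    fun d => signWeight_nonneg (signBias_mem_Icc hx)
  refine tendsto_sum_mul_of_tendsto_sum_mul_dist_sq hM (hF x hx) hx hw
    (fun d => sum_signWeight _) (fun d => signMeanPair_mem) ?_
  refine squeeze_zero (fun d => sum_nonneg fun σ _ => mul_nonneg (hw d σ) (sq_nonneg _))
    (fun d => signExpectation_dist_sq_signMeanPair_le hx) ?_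
  simpa using (tendsto_add_atTop_iff_nat 1).mpr (tendsto_const_div_atTop_nhds_zero_nat (2 : ℝ))

end Bernstein

section PositiveDefinite

variable {X Y : Type*}

theorem IsPositiveDefiniteKernel.comp_injective {K : X → X → ℝ} (hK : IsPositiveDefiniteKernel K)
    {φ : Y → X} (hφ : Function.Injective φ) :
    IsPositiveDefiniteKernel fun y y' => K (φ y) (φ y') :=
  fun n hn y hy c => hK n hn (φ ∘ y) (hφ.comp hy) c

theorem IsPositiveDefiniteKernel.sum_univ_nonneg [Fintype X] {K : X → X → ℝ}
    (hK : IsPositiveDefiniteKernel K) (c : X → ℝ) : 0 ≤ ∑ x, ∑ y, c x * c y * K x y := by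
  cases isEmpty_or_nonempty X
  · simp
  let e := (Fintype.equivFin X).symm
  have h := hK (Fintype.card X) Fintype.card_pos e e.injective (c ∘ e)
  rw [← e.sum_comp]
  simpa only [Function.comp_apply, ← e.sum_comp fun y => c _ * c y * K _ y] using h

theorem IsPositiveDefiniteKernel.sum_monoidHom_mul_nonneg {G : Type*} [Group G] [Fintype G]
    {g : G → ℝ} (hg : IsPositiveDefiniteKernel fun x y => g (x * y)) (χ : G →* ℝ) :
    0 ≤ ∑ x, χ x * g x := by
  have h := hg.sum_univ_nonneg χ
  have htranslate : ∀ x, ∑ y, χ x * χ y * g (x * y) = ∑ y, χ y * g y := fun x => by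
    simp only [← map_mul]
    exact Equiv.sum_comp (Equiv.mulLeft x) fun y => χ y * g y
  simp only [htranslate, sum_const, nsmul_eq_mul] at h
  exact nonneg_of_mul_nonneg_right h (Nat.cast_pos.mpr univ_nonempty.card_pos)

theorem IsPositiveDefiniteKernel.walshCoeff_nonneg {J : Type*} [Fintype J] [DecidableEq J]
    {g : (J → ℤˣ) → ℝ} (hg : IsPositiveDefiniteKernel fun σ τ => g (σ * τ)) (A : Finset J) :
    0 ≤ walshCoeff g A :=
  mul_nonneg (by positivity) (hg.sum_monoidHom_mul_nonneg (walshChar A))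

theorem isPositiveDefiniteKernel_of_posSemidef {K : X → X → ℝ}
    (hK : ∀ n, ∀ x : Fin n → X, (Matrix.of fun i j => K (x i) (x j)).PosSemidef) :
    IsPositiveDefiniteKernel K := fun n _ x _ c => by
  refine ((hK n x).dotProduct_mulVec_nonneg c).trans_eq ?_
  simp only [dotProduct, Matrix.mulVec, Matrix.of_apply, Pi.star_apply, star_trivial, mul_sum]
  exact sum_congr rfl fun i _ => sum_congr rfl fun j _ => by ring

theorem isPositiveDefiniteKernel_of_hasSum {P : Type*} {κ : P → X → X → ℝ} {K : X → X → ℝ}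
    {a : P → ℝ} (ha : ∀ p, 0 ≤ a p) (hκ : ∀ p, IsPositiveDefiniteKernel (κ p))
    (h : ∀ x y, HasSum (fun p => a p * κ p x y) (K x y)) : IsPositiveDefiniteKernel K := by
  intro n hn x hx c
  have hquad : HasSum (fun p => a p * ∑ i, ∑ j, c i * c j * κ p (x i) (x j))
      (∑ i, ∑ j, c i * c j * K (x i) (x j)) := by
    simp only [mul_sum, mul_left_comm (a _)]
    exact hasSum_sum fun i _ => hasSum_sum fun j _ => (h (x i) (x j)).mul_left _
  exact hquad.nonneg fun p => mul_nonneg (ha p) (hκ p n hn x hx c)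

open scoped ComplexOrder in
theorem posSemidef_map_pow {𝕜 ι : Type*} [RCLike 𝕜] [Finite ι] {M : Matrix ι ι 𝕜}
    (hM : M.PosSemidef) (k : ℕ) : (M.map (· ^ k)).PosSemidef := by
  induction k with
  | zero =>
    convert Matrix.posSemidef_vecMulVec_self_star (1 : ι → 𝕜) using 1
    ext i j
    simp [Matrix.vecMulVec_apply]
  | succ k ih =>
    convert ih.hadamard hM using 1
    ext i j
    simp [pow_succ]

end PositiveDefinite

section Sphere

theorem orthonormal_lp_single :
    Orthonormal ℝ fun i : ℕ => (lp.single 2 i (1 : ℝ) : lp (fun _ : ℕ => ℝ) 2) := by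
  rw [orthonormal_iff_ite]
  intro i j
  simp [lp.inner_single_left, lp.single_apply, Pi.single_apply]

theorem inner_cos_smul_add_sin_smul {E : Type*} [NormedAddCommGroup E] [InnerProductSpace ℝ E]
    {u v : E} (hu : ‖u‖ = 1) (hv : ‖v‖ = 1) (huv : inner ℝ u v = 0) (θ φ : ℝ) :
    inner ℝ (Real.cos θ • u + Real.sin θ • v) (Real.cos φ • u + Real.sin φ • v) =
      Real.cos (θ - φ) := by
  simp only [inner_add_left, inner_add_right, inner_smul_left, inner_smul_right,
    real_inner_self_eq_norm_sq, real_inner_comm u v, hu, hv, huv, Real.cos_sub, conj_trivial]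
  ring

namespace HilbertSphere

theorem dot_mem_Icc (x y : HilbertSphere) : dot x y ∈ Set.Icc (-1 : ℝ) 1 := by
  have h := abs_real_inner_le_norm (x : lp (fun _ : ℕ => ℝ) 2) (y : lp (fun _ : ℕ => ℝ) 2)
  rw [norm_eq_of_mem_sphere, norm_eq_of_mem_sphere, one_mul] at h
  exact abs_le.mp h

theorem geodesicDist_self (x : HilbertSphere) : geodesicDist x x = 0 := by
  simp [geodesicDist, dot, norm_eq_of_mem_sphere]

theorem eventually_geodesicDist_lt (x : HilbertSphere) {δ : ℝ} (hδ : 0 < δ) :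
    ∀ᶠ y in 𝓝 x, geodesicDist y x < δ := by
  have hcont : Continuous fun y => geodesicDist y x := by
    unfold geodesicDist dot
    fun_prop
  exact hcont.continuousAt.eventually_lt_const (by simpa only [geodesicDist_self])

theorem isPositiveDefiniteKernel_dot_pow_mul_dot_pow (k l : ℕ) :
    IsPositiveDefiniteKernel fun p q : HilbertSphere × HilbertSphere =>
      dot p.1 q.1 ^ k * dot p.2 q.2 ^ l :=
  isPositiveDefiniteKernel_of_posSemidef fun _ p =>
    have hfst := Matrix.posSemidef_gram ℝ fun i => ((p i).1 : lp (fun _ : ℕ => ℝ) 2)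
    have hsnd := Matrix.posSemidef_gram ℝ fun i => ((p i).2 : lp (fun _ : ℕ => ℝ) 2)
    (posSemidef_map_pow hfst k).hadamard (posSemidef_map_pow hsnd l)

theorem inner_greatCircle (θ φ : ℝ) :
    inner ℝ (Real.cos θ • lp.single 2 0 1 + Real.sin θ • lp.single 2 1 1 : lp (fun _ : ℕ => ℝ) 2)
      (Real.cos φ • lp.single 2 0 1 + Real.sin φ • lp.single 2 1 1) = Real.cos (θ - φ) :=
  inner_cos_smul_add_sin_smul (orthonormal_lp_single.1 0) (orthonormal_lp_single.1 1)
    (orthonormal_lp_single.2 zero_ne_one) θ φ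

/-- The point at angle `θ` on the great circle through the first two coordinate vectors. -/
noncomputable def greatCircle (θ : ℝ) : HilbertSphere :=
  ⟨Real.cos θ • lp.single 2 0 1 + Real.sin θ • lp.single 2 1 1, by
    rw [mem_sphere_zero_iff_norm, norm_eq_sqrt_real_inner, inner_greatCircle, sub_self,
      Real.cos_zero, Real.sqrt_one]⟩

theorem continuous_greatCircle : Continuous greatCircle := by
  unfold greatCircle
  fun_prop

theorem dot_greatCircle (θ φ : ℝ) : dot (greatCircle θ) (greatCircle φ) = Real.cos (θ - φ) :=
  inner_greatCircle θ φ

section Cube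

variable {ι : Type*} [Fintype ι] {e : ι → lp (fun _ : ℕ => ℝ) 2}

theorem inner_sum_sign_smul (he : Orthonormal ℝ e) (σ τ : ι → ℤˣ) :
    inner ℝ (∑ i, ((σ i : ℝ) / √(Fintype.card ι)) • e i)
      (∑ i, ((τ i : ℝ) / √(Fintype.card ι)) • e i) = signMean (σ * τ) := by
  rw [he.inner_sum]
  simp [signMean, div_mul_div_comm, ← sum_div]

variable [Nonempty ι]

/-- The vertex with signs `σ` of the cube inscribed in the unit sphere of the span of an orthonormal
family. -/
noncomputable def cubeVertex (he : Orthonormal ℝ e) (σ : ι → ℤˣ) : HilbertSphere :=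
  ⟨∑ i, ((σ i : ℝ) / √(Fintype.card ι)) • e i, by
    rw [mem_sphere_zero_iff_norm, norm_eq_sqrt_real_inner, inner_sum_sign_smul he,
      signMean_mul_self, Real.sqrt_one]⟩

theorem dot_cubeVertex (he : Orthonormal ℝ e) (σ τ : ι → ℤˣ) :
    dot (cubeVertex he σ) (cubeVertex he τ) = signMean (σ * τ) :=
  inner_sum_sign_smul he σ τ

theorem cubeVertex_injective (he : Orthonormal ℝ e) : Function.Injective (cubeVertex he) := by
  intro σ τ h
  funext i
  have hcoord := congrArg (fun x : HilbertSphere => inner ℝ (e i) (x : lp (fun _ : ℕ => ℝ) 2)) h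
  simp only [cubeVertex, he.inner_right_fintype] at hcoord
  have hcard : √(Fintype.card ι : ℝ) ≠ 0 := by positivity
  rw [div_left_inj' hcard, Int.cast_inj] at hcoord
  exact Units.ext hcoord

theorem cubeVertex_pair_injective (he : Orthonormal ℝ e) :
    Function.Injective fun σ : ι ⊕ ι → ℤˣ =>
      (cubeVertex he (σ ∘ Sum.inl), cubeVertex he (σ ∘ Sum.inr)) := by
  intro σ τ h
  rw [← Sum.elim_comp_inl_inr σ, ← Sum.elim_comp_inl_inr τ,
    cubeVertex_injective he (congrArg Prod.fst h), cubeVertex_injective he (congrArg Prod.snd h)]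

end Cube

end HilbertSphere

end Sphere

section IsotropicPart

open HilbertSphere

variable {K : HilbertSphere × HilbertSphere → HilbertSphere × HilbertSphere → ℝ} {f : ℝ → ℝ → ℝ}

theorem IsContinuousKernel.continuous (hK : IsContinuousKernel K) :
    Continuous (Function.uncurry K) := by
  rw [continuous_iff_continuousAt]
  rintro ⟨p, q⟩
  rw [ContinuousAt, Metric.tendsto_nhds]
  intro ε hε
  obtain ⟨δ, hδ, hclose⟩ := hK p q ε hε
  have hnear : ∀ r : HilbertSphere × HilbertSphere, ∀ᶠ r' in 𝓝 r,
      geodesicDist r'.1 r.1 < δ ∧ geodesicDist r'.2 r.2 < δ := fun r =>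
    (eventually_geodesicDist_lt r.1 hδ).prod_nhds (eventually_geodesicDist_lt r.2 hδ)
  filter_upwards [(hnear p).prod_nhds (hnear q)] with r hr
  exact hclose r.1 r.2 hr.1.1 hr.1.2 hr.2.1 hr.2.2

theorem IsIsotropicPart.continuousOn (hf : IsIsotropicPart K f) (hK : IsContinuousKernel K) :
    ContinuousOn (Function.uncurry f) (Set.Icc (-1) 1 ×ˢ Set.Icc (-1) 1) := by
  let y : ℝ → HilbertSphere := fun t => greatCircle (Real.arccos t)
  have hy : Continuous y := continuous_greatCircle.comp Real.continuous_arccos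
  have hdot : ∀ t ∈ Set.Icc (-1 : ℝ) 1, dot (greatCircle 0) (y t) = t := fun t ht => by
    rw [dot_greatCircle, zero_sub, Real.cos_neg, Real.cos_arccos ht.1 ht.2]
  have hcont : Continuous fun x : ℝ × ℝ =>
      Function.uncurry K ((greatCircle 0, greatCircle 0), (y x.1, y x.2)) :=
    hK.continuous.comp (by fun_prop)
  refine hcont.continuousOn.congr fun x hx => ?_
  simp only [Function.uncurry, hf _ _ _ _, hdot x.1 hx.1, hdot x.2 hx.2]

theorem IsIsotropicPart.isPositiveDefiniteKernel_signMeanPair {ι : Type*} [Fintype ι] [Nonempty ι]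
    {e : ι → lp (fun _ : ℕ => ℝ) 2} (he : Orthonormal ℝ e) (hf : IsIsotropicPart K f)
    (hpd : IsPositiveDefiniteKernel K) :
    IsPositiveDefiniteKernel fun σ τ : ι ⊕ ι → ℤˣ =>
      Function.uncurry f (signMeanPair (σ * τ)) := by
  have h := hpd.comp_injective (cubeVertex_pair_injective he)
  simp only [hf _ _ _ _, dot_cubeVertex] at h
  exact h

theorem IsIsotropicPart.hasNonnegExpansion (hf : IsIsotropicPart K f) (hK : IsContinuousKernel K)
    (hpd : IsPositiveDefiniteKernel K) :
    HasNonnegExpansion bivariateMonomial (Set.Icc (-1) 1 ×ˢ Set.Icc (-1) 1)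
      (Function.uncurry f) := by
  have hcont := hf.continuousOn hK
  refine .bivariateMonomial_of_tendsto (G := fun d => signBernstein (Fin (d + 1)) _)
    (fun d => hasNonnegExpansion_signBernstein (fun A => ?_) _)
    (fun x => tendsto_signBernstein hcont) hcont
  have he := orthonormal_lp_single.comp _ (Fin.val_injective (n := d + 1))
  exact (hf.isPositiveDefiniteKernel_signMeanPair he hpd).walshCoeff_nonneg A

theorem IsIsotropicPart.isPositiveDefiniteKernel (hf : IsIsotropicPart K f)
    (h : HasNonnegExpansion bivariateMonomial (Set.Icc (-1) 1 ×ˢ Set.Icc (-1) 1)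
      (Function.uncurry f)) : IsPositiveDefiniteKernel K := by
  obtain ⟨a, ha, -, hsum⟩ := h
  refine isPositiveDefiniteKernel_of_hasSum ha
    (fun p => isPositiveDefiniteKernel_dot_pow_mul_dot_pow p.1 p.2) fun p q => ?_
  rw [hf]
  exact hsum (_, _) ⟨dot_mem_Icc p.1 q.1, dot_mem_Icc p.2 q.2⟩

end IsotropicPart

theorem mainTheorem3
    (K : HilbertSphere × HilbertSphere → HilbertSphere × HilbertSphere → ℝ)
    (hK : IsContinuousKernel K)
    (f : ℝ → ℝ → ℝ) (hf : IsIsotropicPart K f) :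
    IsPositiveDefiniteKernel K ↔
      ∃ a : ℕ → ℕ → ℝ, (∀ k l, 0 ≤ a k l) ∧
        Summable (fun p : ℕ × ℕ => a p.1 p.2) ∧
        ∀ t ∈ Set.Icc (-1 : ℝ) 1, ∀ s ∈ Set.Icc (-1 : ℝ) 1,
          HasSum (fun p : ℕ × ℕ => a p.1 p.2 * t ^ p.1 * s ^ p.2) (f t s) := by
  refine ⟨fun hpd => ?_, ?_⟩
  · obtain ⟨a, ha, hsum, h⟩ := hf.hasNonnegExpansion hK hpd
    refine ⟨fun k l => a (k, l), fun k l => ha (k, l), hsum, fun t ht s hs => ?_⟩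
    simpa only [bivariateMonomial, mul_assoc, Function.uncurry] using h (t, s) ⟨ht, hs⟩
  · rintro ⟨a, ha, hsum, h⟩
    refine hf.isPositiveDefiniteKernel ⟨fun p => a p.1 p.2, fun p => ha p.1 p.2, hsum, ?_⟩
    intro x hx
    simpa only [bivariateMonomial, mul_assoc, Function.uncurry] using h x.1 hx.1 x.2 hx.2
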